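/- A stochastic shortest path (SSP) problem consists of an MDP with a finite state space $\mathcal S$, an initial state $s_0\in\mathcal S$, a goal state $g\notin\mathcal S$, finite action sets $\mathcal A_s$ and a known transition function $P(\cdot\mid s,a)$ on $\mathcal S\cup\{g\}$, together with cost functions $c_1,\dots,c_K$ that map state-action pairs to $[0,1]$. In each of $K$ episodes a (possibly randomized) learner starts from $s_0$ and selects actions until $g$ is reached; in the full-information setting the whole function $c_k$ is revealed to the learner after episode $k$. A stationary deterministic policy is proper if from every state it reaches $g$ with probability one; $T^\pi(s)$ is the expected number of steps that $\pi$ takes from $s$ to reach $g$, and $J_k^\pi(s)$ is its expected cost under $c_k$. The diameter is $\max_{s}\min_{\pi}T^\pi(s)$, the minimum being over the deterministic proper policies, and an optimal policy is a deterministic proper policy $\pi^\star$ that minimizes $\sum_{k=1}^K J_k^{\pi}(s_0)$. The regret $R_K$ of the learner is her total cost over the $K$ episodes minus $\sum_{k=1}^K J_k^{\pi^\star}(s_0)$. There is a universal constant $C>0$ such that for all real numbers $D,T_\star$ and every natural number $K$ with $1\le D\le T_\star\le 16DK$ there are an MDP that has a proper policy and has diameter exactly $D$, and a probability distribution $\mu$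 on sequences $(c_1,\dots,c_K)$ of cost functions, such that for every sequence in the support of $\mu$ an optimal policy exists and every optimal policy $\pi^\star$ satisfies $T^{\pi^\star}(s_0)=T_\star$, and such that every learner in the full-information setting (even one that knows the MDP, $K$ and $\mu$) satisfies $$\mathbb E[R_K]\ \ge\ C\sqrt{D\,T_\star K},$$ the expectation being over the costs drawn from $\mu$, the transitions and the learner's randomness. In particular, for every learner there is a fixed sequence of cost functions in the support of $\mu$ against which her expected regret is at least $C\sqrt{D\,T_\star K}$. -/

import Mathlib

open scoped ENNReal

noncomputable section

/-- The MDP of a stochastic shortest path problem: finitely many non-goal states, finitely many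
available actions at each of them, an initial state, and a transition function. The goal state is
`none : Option State`, so that it is not an element of `State`. -/
structure SSP where
  State : Type
  Act : State → Type
  finite_state : Finite State
  finite_act : ∀ s, Finite (Act s)
  init : State
  trans : (s : State) → Act s → PMF (Option State)

namespace SSP

variable (M : SSP)

/-- A cost function: a cost in `[0, 1]` for every valid state-action pair. -/
abbrev Cost : Type := (s : M.State) → M.Act s → Set.Icc (0 : ℝ) 1

/-! ### Stationary deterministic policies -/

/-- A stationary deterministic policy. -/
abbrev Policy : Type := (s : M.State) → M.Act s

variable {M}

/-- The law of the state after `n` steps when `π` is executed from the state `s`. The goal state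
is absorbing. -/
def stateLaw (π : M.Policy) (s : M.State) : ℕ → PMF (Option M.State)
  | 0 => PMF.pure (some s)
  | n + 1 => (stateLaw π s n).bind fun x =>
      match x with
      | none => PMF.pure none
      | some s' => M.trans s' (π s')

/-- `π` is proper: from every state, the goal is reached in finitely many steps with
probability one. -/
def IsProper (π : M.Policy) : Prop :=
  ∀ s, Filter.Tendsto (fun n => stateLaw π s n none) Filter.atTop (nhds 1)

/-- `T^π(s)`: the expected number of steps that `π` takes, from `s`, to reach the goal, that is, the
expected number of times `n` at which the state is not the goal. -/
def hittingTime (π : M.Policy) (s : M.State) : ℝ≥0∞ :=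
  ∑' n, ∑' s', stateLaw π s n (some s')

/-- `J^π(s)`: the expected total cost that `π` incurs, from `s`, until the goal is reached. -/
def costToGo (c : M.Cost) (π : M.Policy) (s : M.State) : ℝ≥0∞ :=
  ∑' n, ∑' s', stateLaw π s n (some s') * ENNReal.ofReal (c s' (π s'))

variable (M) in
/-- The diameter `D = max_s min_π T^π(s)`, `π` ranging over the deterministic proper policies. -/
def diameter : ℝ≥0∞ :=
  ⨆ s : M.State, ⨅ π : {π : M.Policy // IsProper π}, hittingTime π.1 s

/-- Total expected cost of `π` from the initial state in `K` episodes with costs `c`. -/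
def policyCost {K : ℕ} (c : Fin K → M.Cost) (π : M.Policy) : ℝ≥0∞ :=
  ∑ k, costToGo (c k) π M.init

/-- Total expected cost of the best deterministic proper policy in hindsight. -/
def bestCost {K : ℕ} (c : Fin K → M.Cost) : ℝ≥0∞ :=
  ⨅ π : {π : M.Policy // IsProper π}, policyCost c π.1

/-- `π` is an optimal deterministic proper policy in hindsight for the costs `c`. -/
def IsOptimal {K : ℕ} (c : Fin K → M.Cost) (π : M.Policy) : Prop :=
  IsProper π ∧ ∀ π' : M.Policy, IsProper π' → policyCost c π ≤ policyCost c π'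

/-! ### Learners with full information -/

variable (M)

/-- A sequence of visited state-action pairs. -/
abbrev Path : Type := List ((s : M.State) × M.Act s)

/-- What is known about a completed episode under full information: the state-action pairs
visited, and the entire cost function of that episode. -/
structure Record where
  path : M.Path
  cost : M.Cost

/-- A (randomized) learner: from the records of all completed episodes, the state-action pairs
visited so far in the running episode, and the current state, it chooses a distribution over the
actions available there. -/
abbrev Learner : Type := List M.Record → M.Path → (s : M.State) → PMF (M.Act s)

/-- The situation at some time of the interaction: the completed episodes, the running one up
to now, and the current state. -/
structure Config where
  past : List M.Record
  path : M.Path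
  state : M.State

variable {M}

/-- The situation after action `a` was taken in the situation `h` with resulting state `x`, when
`c` is the cost function of the running episode. When the goal is reached, `c` is revealed and the
next episode starts in the initial state. -/
def Config.next (h : M.Config) (c : M.Cost) (a : M.Act h.state) : Option M.State → M.Config
  | some s' => ⟨h.past, h.path ++ [⟨h.state, a⟩], s'⟩
  | none => ⟨h.past ++ [⟨h.path ++ [⟨h.state, a⟩], c⟩], [], M.init⟩

/-- One step of the interaction of `L` with the costs `c`. Nothing happens any more once `K`
episodes are completed. -/
def step {K : ℕ} (c : Fin K → M.Cost) (L : M.Learner) (h : M.Config) : PMF M.Config :=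
  if hK : h.past.length < K then
    (L h.past h.path h.state).bind fun a =>
      (M.trans h.state a).map (h.next (c ⟨h.past.length, hK⟩) a)
  else PMF.pure h

/-- Law of the situation after `n` steps in total, over all episodes. -/
def configLaw {K : ℕ} (c : Fin K → M.Cost) (L : M.Learner) : ℕ → PMF M.Config
  | 0 => PMF.pure ⟨[], [], M.init⟩
  | n + 1 => (configLaw c L n).bind (step c L)

/-- Expected cost of the action that `L` takes in the situation `h` (zero once `K` episodes are
completed). -/
def stepCost {K : ℕ} (c : Fin K → M.Cost) (L : M.Learner) (h : M.Config) : ℝ≥0∞ :=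
  if hK : h.past.length < K then
    ∑' a, L h.past h.path h.state a * ENNReal.ofReal (c ⟨h.past.length, hK⟩ h.state a)
  else 0

/-- Expected total cost of the learner over the `K` episodes, that is, over all steps. -/
def learnerCost {K : ℕ} (c : Fin K → M.Cost) (L : M.Learner) : ℝ≥0∞ :=
  ∑' n, ∑' h, configLaw c L n h * stepCost c L h

/-- Expected regret `E[R_K]` of `L` against the fixed cost functions `c`, over the randomness of
the transitions and of the learner. -/
def expectedRegret {K : ℕ} (c : Fin K → M.Cost) (L : M.Learner) : EReal :=
  (learnerCost c L : EReal) - (bestCost c : EReal)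

/-- Expected regret `E[R_K]` of `L` when, in addition, the cost functions are drawn from `μ` before
the first episode; `L` observes them only through the interaction. -/
def meanRegret {K : ℕ} (μ : PMF (Fin K → M.Cost)) (L : M.Learner) : EReal :=
  ((∑' c, μ c * learnerCost c L : ℝ≥0∞) : EReal) - ((∑' c, μ c * bestCost c : ℝ≥0∞) : EReal)

end SSP

end

noncomputable section

/-! ### Expectations of extended nonnegative functions under a `PMF` -/

namespace PMF

variable {α β : Type*}

/-! One non-goal state suffices. A fast action exits with probability `1 / D` and always costs 1;
two slow actions exit with probability `1 / T` and cost 1 only in the active episodes of their sign.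
Episodes are cut into blocks of length `B`, between `T / D` and `2 * T / D`; each block has at most
one active episode, of random position and sign.

Each completed episode uses up one unit of expected exit probability. Given the past, an episode is
active with a given sign with probability at most `1 / (2 * B)`, so per unit of exit probability a
slow action costs at most `T / (2 * B) ≤ D` on average, the price of the fast one, and the two signs
are indistinguishable. Hence every learner pays on average at least `T` times the mean number of
active episodes of one sign (`sum_le_sum_learnerCost_oneState`, `mul_sum_mul_hit_le`,
`sum_hitCount_le_sum_learnerCost`).

In hindsight the better sign costs `T` times the smaller count. The mean gap is half the mean
absolute difference of the counts, a sum of independent symmetric variables of total variance `K /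
(2 * B)`, of order `D * K / T`. Comparing second and fourth moments (`le_sum_pi_abs_sum`) gives a
gap of order `T * √(D * K / T) = √(D * T * K)`. As the smaller count is below `K / B`, slow policies
beat the fast one for every draw (`mul_min_hitCount_lt`). -/

theorem tsum_pure_mul (a : α) (F : α → ℝ≥0∞) : ∑' b, PMF.pure a b * F b = F a := by
  rw [tsum_eq_single a fun b hb => by simp [PMF.pure_apply, hb]]
  simp

theorem tsum_bind_mul (p : PMF α) (f : α → PMF β) (F : β → ℝ≥0∞) :
    ∑' b, p.bind f b * F b = ∑' a, p a * ∑' b, f a b * F b := by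
  simp_rw [PMF.bind_apply, ← ENNReal.tsum_mul_right, ← ENNReal.tsum_mul_left]
  rw [ENNReal.tsum_comm]
  simp_rw [mul_assoc]

theorem tsum_map_mul (p : PMF α) (f : α → β) (F : β → ℝ≥0∞) :
    ∑' b, p.map f b * F b = ∑' a, p a * F (f a) := by
  rw [PMF.map, tsum_bind_mul]
  simp_rw [Function.comp_apply, tsum_pure_mul]

end PMF

theorem ENNReal.sum_tsum_tsum {ι α β : Type*} (s : Finset ι) (f : ι → α → β → ℝ≥0∞) :
    ∑ i ∈ s, ∑' a, ∑' b, f i a b = ∑' a, ∑' b, ∑ i ∈ s, f i a b := by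
  simp_rw [Summable.tsum_finsetSum fun _ _ => ENNReal.summable]

namespace SSP

variable {M : SSP} {K : ℕ}

/-! ### The steps that a learner takes in one episode -/

theorem tsum_step_mul (c : Fin K → M.Cost) (L : M.Learner) (h : M.Config)
    (F : M.Config → ℝ≥0∞) :
    ∑' h', step c L h h' * F h' =
      if hK : h.past.length < K then
        ∑' a, L h.past h.path h.state a *
          ∑' x, M.trans h.state a x * F (h.next (c ⟨h.past.length, hK⟩) a x)
      else F h := by
  unfold step
  split_ifs with hK
  · rw [PMF.tsum_bind_mul]
    simp_rw [PMF.tsum_map_mul]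
  · rw [PMF.tsum_pure_mul]

/-- The expected sum of `F s a` over the state-action pairs `(s, a)` that `L` visits in
episode `k`. -/
def episodeSum (c : Fin K → M.Cost) (L : M.Learner) (k : ℕ)
    (F : (s : M.State) → M.Act s → ℝ≥0∞) : ℝ≥0∞ :=
  ∑' n, ∑' h, configLaw c L n h *
    if h.past.length = k then ∑' a, L h.past h.path h.state a * F h.state a else 0

theorem learnerCost_eq_sum_episodeSum (c : Fin K → M.Cost) (L : M.Learner) :
    learnerCost c L =
      ∑ k : Fin K, episodeSum c L k fun s a => ENNReal.ofReal (c k s a) := by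
  unfold learnerCost episodeSum
  rw [ENNReal.sum_tsum_tsum]
  refine tsum_congr fun n => tsum_congr fun h => ?_
  rw [← Finset.mul_sum]
  congr 1
  unfold stepCost
  split_ifs with hK
  · rw [Finset.sum_eq_single ⟨h.past.length, hK⟩]
    · simp
    · intro k _ hk
      rw [if_neg]
      exact fun hk' => hk (Fin.ext hk'.symm)
    · simp
  · rw [Finset.sum_eq_zero]
    intro k _
    rw [if_neg]
    intro hk
    exact hK (hk ▸ k.2)

/-- The probability that more than `k` episodes are completed after `n` steps. -/
def completedProb (c : Fin K → M.Cost) (L : M.Learner) (k n : ℕ) : ℝ≥0∞ :=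
  ∑' h, configLaw c L n h * if k < h.past.length then 1 else 0

theorem completedProb_le_one (c : Fin K → M.Cost) (L : M.Learner) (k n : ℕ) :
    completedProb c L k n ≤ 1 := by
  rw [← (configLaw c L n).tsum_coe]
  refine ENNReal.tsum_le_tsum fun h => ?_
  split_ifs <;> simp

/-- A step completes at most one episode, so the count can pass `k` only by an exit from a situation
with exactly `k` completed episodes. Summed over time, this telescopes. -/
theorem tsum_step_mul_completed (c : Fin K → M.Cost) (L : M.Learner) {k : ℕ} (hk : k < K)
    (h : M.Config) :
    (∑' h', step c L h h' * if k < h'.past.length then 1 else 0) =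
      (if k < h.past.length then 1 else 0) +
        if h.past.length = k then
          ∑' a, L h.past h.path h.state a * M.trans h.state a none else 0 := by
  rw [tsum_step_mul]
  split_ifs with h1 h2 h3 h3 h2 h3 h3
  · omega
  · have : ∀ (a : M.Act h.state) (x : Option M.State),
        (if k < (h.next (c ⟨h.past.length, h1⟩) a x).past.length then (1 : ℝ≥0∞) else 0) = 1 := by
      intro a x
      rw [if_pos]
      cases x <;> simp [Config.next] <;> omega
    simp only [this, mul_one, PMF.tsum_coe, add_zero]
  · rw [zero_add]
    refine tsum_congr fun a => ?_
    rw [tsum_eq_single none]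
    · rw [if_pos, mul_one]
      simp [Config.next]; omega
    · intro x hx
      cases x with
      | none => exact absurd rfl hx
      | some x => simp [Config.next, h2]
  · have : ∀ (a : M.Act h.state) (x : Option M.State),
        (if k < (h.next (c ⟨h.past.length, h1⟩) a x).past.length then (1 : ℝ≥0∞) else 0) = 0 := by
      intro a x
      rw [if_neg]
      cases x <;> simp [Config.next] <;> omega
    simp only [this, mul_zero, tsum_zero, add_zero]
  all_goals first | omega | simp

theorem completedProb_succ (c : Fin K → M.Cost) (L : M.Learner) {k : ℕ} (hk : k < K) (n : ℕ) :
    completedProb c L k (n + 1) = completedProb c L k n +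
      ∑' h, configLaw c L n h * if h.past.length = k then
        ∑' a, L h.past h.path h.state a * M.trans h.state a none else 0 := by
  unfold completedProb
  rw [configLaw, PMF.tsum_bind_mul, ← ENNReal.tsum_add]
  refine tsum_congr fun h => ?_
  rw [tsum_step_mul_completed c L hk, mul_add]

theorem completedProb_eq_sum (c : Fin K → M.Cost) (L : M.Learner) {k : ℕ} (hk : k < K) (n : ℕ) :
    completedProb c L k n = ∑ i ∈ Finset.range n,
      ∑' h, configLaw c L i h * if h.past.length = k then
        ∑' a, L h.past h.path h.state a * M.trans h.state a none else 0 := by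
  induction n with
  | zero =>
    simp only [completedProb, configLaw, Finset.range_zero, Finset.sum_empty]
    rw [PMF.tsum_pure_mul]
    simp
  | succ n ih => rw [completedProb_succ c L hk, Finset.sum_range_succ, ih]

theorem episodeSum_trans_none_le_one (c : Fin K → M.Cost) (L : M.Learner) {k : ℕ} (hk : k < K) :
    episodeSum c L k (fun s a => M.trans s a none) ≤ 1 := by
  unfold episodeSum
  rw [ENNReal.tsum_eq_iSup_nat]
  refine iSup_le fun n => ?_
  rw [← completedProb_eq_sum c L hk]
  exact completedProb_le_one c L k n

/-- The probability that fewer than `K` episodes are completed tends to zero if the goal can be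
reached in one step, with a probability bounded below, whatever the learner does. -/
theorem tendsto_running (c : Fin K → M.Cost) (L : M.Learner) {ε : ℝ≥0∞} (hε : ε ≠ 0)
    (hM : ∀ s a, ε ≤ M.trans s a none) :
    Filter.Tendsto (fun n => ∑' h, configLaw c L n h * if h.past.length < K then 1 else 0)
      Filter.atTop (nhds 0) := by
  -- Every running step exits with probability at least `ε`, and at most `K` exits are expected in
  -- total, so the expected number of running steps is finite.
  apply ENNReal.tendsto_atTop_zero_of_tsum_ne_top
  have key : (∑' n, ∑' h, configLaw c L n h * if h.past.length < K then (1 : ℝ≥0∞) else 0) * ε ≤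
      ∑ k : Fin K, episodeSum c L k (fun s a => M.trans s a none) := by
    unfold episodeSum
    rw [ENNReal.sum_tsum_tsum, ← ENNReal.tsum_mul_right]
    refine ENNReal.tsum_le_tsum fun n => ?_
    rw [← ENNReal.tsum_mul_right]
    refine ENNReal.tsum_le_tsum fun h => ?_
    rw [← Finset.mul_sum, mul_assoc]
    gcongr
    split_ifs with hK
    · refine le_trans ?_ (Finset.single_le_sum (fun _ _ => zero_le) (Finset.mem_univ ⟨_, hK⟩))
      rw [if_pos rfl, one_mul]
      calc ε = ∑' a, L h.past h.path h.state a * ε := by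
            rw [ENNReal.tsum_mul_right, PMF.tsum_coe, one_mul]
        _ ≤ _ := ENNReal.tsum_le_tsum fun a => by gcongr; exact hM _ _
    · simp
  have hle : ∑ k : Fin K, episodeSum c L k (fun s a => M.trans s a none) ≤ K := by
    calc _ ≤ ∑ _k : Fin K, (1 : ℝ≥0∞) :=
          Finset.sum_le_sum fun k _ => episodeSum_trans_none_le_one c L k.2
      _ = K := by simp
  intro htop
  rw [htop, ENNReal.top_mul hε] at key
  exact absurd (key.trans hle) (by simp)

/-- Every episode is completed if the goal can be reached in one step, with a probability bounded
below, whatever the learner does. -/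
theorem one_le_episodeSum_trans_none (c : Fin K → M.Cost) (L : M.Learner) {ε : ℝ≥0∞} (hε : ε ≠ 0)
    (hM : ∀ s a, ε ≤ M.trans s a none) {k : ℕ} (hk : k < K) :
    1 ≤ episodeSum c L k (fun s a => M.trans s a none) := by
  -- At each time either more than `k` episodes are completed or fewer than `K` are; the probability
  -- of the latter vanishes in the limit.
  have h := (tendsto_running c L hε hM).const_add
    (episodeSum c L k (fun s a => M.trans s a none))
  rw [add_zero] at h
  refine ge_of_tendsto' h fun n => ?_
  calc (1 : ℝ≥0∞) ≤ completedProb c L k n +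
        ∑' h, configLaw c L n h * if h.past.length < K then 1 else 0 := by
        unfold completedProb
        rw [← ENNReal.tsum_add, ← (configLaw c L n).tsum_coe]
        refine ENNReal.tsum_le_tsum fun h => ?_
        rw [← mul_add]
        refine le_mul_of_one_le_right zero_le ?_
        split_ifs <;> first | omega | simp
    _ ≤ _ := by
        gcongr
        rw [completedProb_eq_sum c L hk]
        exact ENNReal.sum_le_tsum _

/-- The costs of an episode enter a situation only through the record appended at its end. For an
episode of index at least `k`, that makes the past longer than `k`. -/
theorem step_congr {c c' : Fin K → M.Cost} (L : M.Learner) {k : ℕ}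
    (hc : ∀ i : Fin K, (i : ℕ) < k → c i = c' i) (h h' : M.Config) (hh' : h'.past.length ≤ k) :
    step c L h h' = step c' L h h' := by
  unfold step
  split_ifs with hK
  · rw [PMF.bind_apply, PMF.bind_apply]
    refine tsum_congr fun a => ?_
    congr 1
    rw [PMF.map_apply, PMF.map_apply]
    refine tsum_congr fun x => ?_
    cases x with
    | some x => rfl
    | none =>
      by_cases hk : h.past.length < k
      · rw [hc ⟨_, hK⟩ hk]
      · have : ∀ d : M.Cost, h' ≠ h.next d a none := by
          rintro d rfl
          simp [Config.next] at hh'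
          omega
        rw [if_neg (this _), if_neg (this _)]
  · rfl

/-- Until episode `k` is completed, its costs and those of later episodes have no influence. -/
theorem configLaw_congr {c c' : Fin K → M.Cost} (L : M.Learner) {k : ℕ}
    (hc : ∀ i : Fin K, (i : ℕ) < k → c i = c' i) (n : ℕ) (h : M.Config)
    (hh : h.past.length ≤ k) : configLaw c L n h = configLaw c' L n h := by
  induction n generalizing h with
  | zero => rfl
  | succ n ih =>
    rw [configLaw, configLaw, PMF.bind_apply, PMF.bind_apply]
    refine tsum_congr fun h₀ => ?_
    rw [step_congr L hc h₀ h hh]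
    by_cases h0 : h₀.past.length ≤ k
    · rw [ih h₀ h0]
    -- The past never gets shorter.
    · have : step c' L h₀ h = 0 := by
        rw [PMF.apply_eq_zero_iff]
        unfold step
        split_ifs with hK
        · simp only [PMF.mem_support_bind_iff, PMF.mem_support_map_iff, not_exists, not_and]
          rintro a _ x _ rfl
          cases x <;> simp [Config.next] at hh <;> omega
        · rw [PMF.mem_support_pure_iff]
          rintro rfl
          exact h0 hh
      rw [this, mul_zero, mul_zero]

theorem episodeSum_congr {c c' : Fin K → M.Cost} (L : M.Learner) {k : ℕ}
    (hc : ∀ i : Fin K, (i : ℕ) < k → c i = c' i) (F : (s : M.State) → M.Act s → ℝ≥0∞) :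
    episodeSum c L k F = episodeSum c' L k F := by
  unfold episodeSum
  refine tsum_congr fun n => tsum_congr fun h => ?_
  split_ifs with hh
  · rw [configLaw_congr L hc n h hh.le]
  · simp

theorem episodeSum_finset_sum {ι : Type*} (c : Fin K → M.Cost) (L : M.Learner) (k : ℕ)
    (s : Finset ι) (w : ι → ℝ≥0∞) (F : ι → (s : M.State) → M.Act s → ℝ≥0∞) :
    episodeSum c L k (fun x a => ∑ i ∈ s, w i * F i x a) =
      ∑ i ∈ s, w i * episodeSum c L k (F i) := by
  classical
  induction s using Finset.induction_on with
  | empty => simp [episodeSum]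
  | insert i s hi ih =>
    rw [Finset.sum_insert hi, ← ih]
    simp only [episodeSum, Finset.sum_insert hi, ← ENNReal.tsum_mul_left, ← ENNReal.tsum_add]
    refine tsum_congr fun n => tsum_congr fun h => ?_
    split_ifs
    · simp_rw [mul_add, ← ENNReal.tsum_mul_left, ← ENNReal.tsum_add]
      refine tsum_congr fun a => ?_
      ring
    · simp

end SSP

namespace SSP

/-! ### Problems with a single state -/

/-- The problem with a single non-goal state, where action `a` reaches the goal with probability
`e a` and has no effect otherwise. -/
abbrev oneState {A : Type} [Finite A] (e : A → ℝ≥0∞) (he : ∀ a, e a ≤ 1) : SSP where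
  State := Unit
  Act _ := A
  finite_state := inferInstance
  finite_act _ := inferInstance
  init := ()
  trans _ a := PMF.ofFintype (fun x => x.elim (e a) fun _ => 1 - e a) (by
    simp [Fintype.sum_option, add_tsub_cancel_of_le (he a)])

variable {A : Type} [Finite A] {e : A → ℝ≥0∞} {he : ∀ a, e a ≤ 1}

theorem tsum_oneState_state (f : (oneState e he).State → ℝ≥0∞) : ∑' s, f s = f () :=
  tsum_fintype (β := Unit) f |>.trans (by simp)

theorem stateLaw_oneState_some (π : (oneState e he).Policy) (s s' : (oneState e he).State)
    (n : ℕ) : stateLaw π s n (some s') = (1 - e (π ())) ^ n := by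
  induction n with
  | zero =>
    rw [stateLaw, PMF.pure_apply, pow_zero, if_pos]
    rfl
  | succ n ih =>
    rw [stateLaw, PMF.bind_apply, tsum_eq_single (some s'), ih, pow_succ]
    · rfl
    · intro x hx
      cases x with
      | none => simp
      | some x => exact absurd rfl hx

theorem stateLaw_oneState_none (π : (oneState e he).Policy) (s : (oneState e he).State)
    (n : ℕ) : stateLaw π s n none = 1 - (1 - e (π ())) ^ n := by
  have h := (stateLaw π s n).tsum_coe
  have h2 : ∑' x, stateLaw π s n x = ∑ x : Option Unit, stateLaw π s n x :=
    tsum_fintype (β := Option Unit) _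
  rw [h2, Fintype.sum_option] at h
  have h3 : ∑ x : Unit, stateLaw π s n (some x) = (1 - e (π ())) ^ n := by
    rw [Fintype.sum_unique]
    exact stateLaw_oneState_some π s _ n
  rw [h3] at h
  exact ENNReal.eq_sub_of_add_eq (ENNReal.pow_ne_top (by simp)) h

theorem one_sub_lt_one_of_pos {x : ℝ≥0∞} (hx : x ≠ 0) : 1 - x < 1 :=
  ENNReal.sub_lt_self ENNReal.one_ne_top one_ne_zero hx

theorem isProper_oneState (π : (oneState e he).Policy) (h : e (π ()) ≠ 0) : IsProper π := by
  intro s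
  rw [funext (stateLaw_oneState_none π s)]
  have := ENNReal.Tendsto.sub (tendsto_const_nhds (x := (1 : ℝ≥0∞)))
    (ENNReal.tendsto_pow_atTop_nhds_zero_of_lt_one (one_sub_lt_one_of_pos h))
    (Or.inl ENNReal.one_ne_top)
  simpa using this

theorem tsum_geometric_one_sub {x : ℝ≥0∞} (hx : x ≤ 1) : ∑' n, (1 - x) ^ n = x⁻¹ := by
  rw [ENNReal.tsum_geometric, ENNReal.sub_sub_cancel ENNReal.one_ne_top hx]

theorem hittingTime_oneState (π : (oneState e he).Policy) (s : (oneState e he).State) :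
    hittingTime π s = (e (π ()))⁻¹ := by
  rw [← tsum_geometric_one_sub (he _)]
  exact tsum_congr fun n =>
    (tsum_oneState_state _).trans (stateLaw_oneState_some π s () n)

theorem costToGo_oneState (c : (oneState e he).Cost) (π : (oneState e he).Policy)
    (s : (oneState e he).State) :
    costToGo c π s = (e (π ()))⁻¹ * ENNReal.ofReal (c () (π ())) := by
  rw [← tsum_geometric_one_sub (he _), ← ENNReal.tsum_mul_right]
  exact tsum_congr fun n => (tsum_oneState_state _).trans
    (congrArg (· * _) (stateLaw_oneState_some π s () n))

theorem diameter_oneState (h : ∀ a, e a ≠ 0) :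
    (oneState e he).diameter = ⨅ a, (e a)⁻¹ := by
  unfold diameter
  simp_rw [hittingTime_oneState]
  have : ∀ x : ℝ≥0∞, (⨆ _ : (oneState e he).State, x) = x := fun x =>
    ciSup_const (ι := Unit)
  rw [this]
  refine le_antisymm (le_iInf fun a => ?_) (le_iInf fun π => iInf_le _ _)
  exact iInf_le (fun π : {π : (oneState e he).Policy // IsProper π} => (e (π.1 ()))⁻¹)
    ⟨fun _ => a, isProper_oneState _ (h a)⟩

theorem policyCost_oneState {K : ℕ} (c : Fin K → (oneState e he).Cost)
    (π : (oneState e he).Policy) :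
    policyCost c π = (e (π ()))⁻¹ * ∑ k, ENNReal.ofReal (c k () (π ())) := by
  unfold policyCost
  simp_rw [costToGo_oneState, Finset.mul_sum]

theorem bestCost_oneState_le {K : ℕ} (h : ∀ a, e a ≠ 0) (c : Fin K → (oneState e he).Cost)
    (a : A) : bestCost c ≤ (e a)⁻¹ * ∑ k, ENNReal.ofReal (c k () a) :=
  (iInf_le _ ⟨fun _ => a, isProper_oneState _ (h a)⟩).trans_eq (policyCost_oneState c _)

theorem exists_isOptimal_oneState {K : ℕ} [Nonempty A] (h : ∀ a, e a ≠ 0)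
    (c : Fin K → (oneState e he).Cost) : ∃ π : (oneState e he).Policy, IsOptimal c π := by
  obtain ⟨a, ha⟩ := Finite.exists_min fun a => (e a)⁻¹ * ∑ k, ENNReal.ofReal (c k () a)
  refine ⟨fun _ => a, isProper_oneState _ (h a), fun π' _ => ?_⟩
  rw [policyCost_oneState, policyCost_oneState]
  exact ha _

/-- Suppose that the cost functions are drawn uniformly from the family `c`, and that `r k` is, up
to a conditional expectation given the costs of the first `k` episodes, a lower bound on the cost
of each action in episode `k` per unit of its probability of reaching the goal. Then the learner
pays at least the sum of the `r k` on average. -/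
theorem sum_le_sum_learnerCost_oneState {Ω : Type*} [Fintype Ω] {K : ℕ}
    (h : ∀ a, e a ≠ 0) (c : Ω → Fin K → (oneState e he).Cost) (r : Fin K → Ω → ℝ≥0∞)
    (hr : ∀ (k : Fin K) (a : A) (f : Ω → ℝ≥0∞),
      (∀ ω ω', (∀ i < k, c ω i = c ω' i) → f ω = f ω') →
      e a * ∑ ω, f ω * r k ω ≤ ∑ ω, f ω * ENNReal.ofReal (c ω k () a))
    (L : (oneState e he).Learner) :
    ∑ ω, ∑ k, r k ω ≤ ∑ ω, learnerCost (c ω) L := by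
  classical
  have := Fintype.ofFinite A
  simp_rw [learnerCost_eq_sum_episodeSum]
  refine (Finset.sum_comm.trans_le ?_).trans_eq Finset.sum_comm
  refine Finset.sum_le_sum fun k _ => ?_
  -- With these indicators, `x ω a` is the expected number of times that `a` is used in episode `k`;
  -- every episode sum is linear in these numbers.
  let u (a : A) : (s : (oneState e he).State) → (oneState e he).Act s → ℝ≥0∞ :=
    fun _ b => if b = a then 1 else 0
  let x (ω : Ω) (a : A) : ℝ≥0∞ := episodeSum (c ω) L k (u a)
  have hx (ω : Ω) (F : (s : (oneState e he).State) → (oneState e he).Act s → ℝ≥0∞) :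
      episodeSum (c ω) L k F = ∑ a, F () a * x ω a := by
    have hF (G : A → ℝ≥0∞) (a : A) : G a = ∑ i, G i * if a = i then 1 else 0 := by simp
    rw [← episodeSum_finset_sum]
    congr 1
    ext s a
    exact hF (F ()) a
  obtain ⟨ε, hε0, hε⟩ : ∃ ε : ℝ≥0∞, ε ≠ 0 ∧ ∀ a, ε ≤ e a := by
    cases isEmpty_or_nonempty A
    · exact ⟨1, one_ne_zero, fun a => isEmptyElim a⟩
    · obtain ⟨a, ha⟩ := Finite.exists_min e
      exact ⟨e a, h a, ha⟩
  calc ∑ ω, r k ω ≤ ∑ ω, (∑ a, e a * x ω a) * r k ω := by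
        refine Finset.sum_le_sum fun ω _ => le_mul_of_one_le_left zero_le ?_
        have := one_le_episodeSum_trans_none (c ω) L hε0 (fun _ a => hε a) k.2
        rwa [hx] at this
    _ = ∑ a, e a * ∑ ω, x ω a * r k ω := by
        simp_rw [Finset.sum_mul, Finset.mul_sum]
        rw [Finset.sum_comm]
        simp_rw [mul_assoc]
    _ ≤ ∑ a, ∑ ω, x ω a * ENNReal.ofReal (c ω k () a) := by
        refine Finset.sum_le_sum fun a _ => hr k a _ fun ω ω' hω => ?_
        -- The expected action counts of episode `k` depend only on earlier costs, so `hr` applies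
        -- to them as weights.
        exact episodeSum_congr L (fun i hi => hω i hi) _
    _ = ∑ ω, episodeSum (c ω) L k fun s a => ENNReal.ofReal (c ω k s a) := by
        rw [Finset.sum_comm]
        refine Finset.sum_congr rfl fun ω _ => ?_
        rw [hx]
        simp_rw [mul_comm]

end SSP

/-! ### Moments of sums of independent variables on a finite product space -/

section Moments

theorem sum_sum_add_sq {α γ : Type*} [Fintype α] [Fintype γ] (a : α → ℝ) (S : γ → ℝ)
    (ha : ∑ x, a x = 0) :
    ∑ x, ∑ y, (a x + S y) ^ 2 =
      Fintype.card γ * ∑ x, a x ^ 2 + Fintype.card α * ∑ y, S y ^ 2 := by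
  have h : ∀ x, ∑ y, (a x + S y) ^ 2 =
      Fintype.card γ * a x ^ 2 + a x * (2 * ∑ y, S y) + ∑ y, S y ^ 2 := by
    intro x
    rw [← smul_eq_mul (Fintype.card γ : ℝ), Nat.cast_smul_eq_nsmul, ← Finset.card_univ,
      ← Finset.sum_const]
    simp_rw [Finset.mul_sum, ← Finset.sum_add_distrib]
    exact Finset.sum_congr rfl fun y _ => by ring
  simp_rw [h, Finset.sum_add_distrib, ← Finset.mul_sum, ← Finset.sum_mul, ha]
  simp

/-- In the binomial expansion the odd powers of `a` average to zero, so no odd moment of `S` is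
needed. -/
theorem sum_sum_add_pow_four {α γ : Type*} [Fintype α] [Fintype γ] (a : α → ℝ) (S : γ → ℝ)
    (ha : ∑ x, a x = 0) (ha3 : ∑ x, a x ^ 3 = 0) :
    ∑ x, ∑ y, (a x + S y) ^ 4 =
      Fintype.card γ * ∑ x, a x ^ 4 + 6 * (∑ x, a x ^ 2) * (∑ y, S y ^ 2) +
        Fintype.card α * ∑ y, S y ^ 4 := by
  have h : ∀ x, ∑ y, (a x + S y) ^ 4 =
      Fintype.card γ * a x ^ 4 + a x ^ 3 * (4 * ∑ y, S y) + a x ^ 2 * (6 * ∑ y, S y ^ 2) +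
        a x * (4 * ∑ y, S y ^ 3) + ∑ y, S y ^ 4 := by
    intro x
    rw [← smul_eq_mul (Fintype.card γ : ℝ), Nat.cast_smul_eq_nsmul, ← Finset.card_univ,
      ← Finset.sum_const]
    simp_rw [Finset.mul_sum, ← Finset.sum_add_distrib]
    exact Finset.sum_congr rfl fun y _ => by ring
  simp_rw [h, Finset.sum_add_distrib, ← Finset.mul_sum, ← Finset.sum_mul, ha, ha3]
  simp only [zero_mul, add_zero, Finset.sum_const, nsmul_eq_mul, Finset.card_univ]
  ring

variable {β : Type*} [Fintype β]

theorem sum_fin_succ_pi {m : ℕ} (g : (Fin (m + 1) → β) → ℝ) :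
    ∑ ω, g ω = ∑ x, ∑ ω : Fin m → β, g (Fin.cons x ω) := by
  rw [← Fintype.sum_prod_type', ← (Fin.consEquiv fun _ => β).sum_comp]
  rfl

theorem sum_pi_sum_eq_zero {m : ℕ} (X : Fin m → β → ℝ) (h1 : ∀ j, ∑ x, X j x = 0) :
    ∑ ω : Fin m → β, ∑ j, X j (ω j) = 0 := by
  induction m with
  | zero => simp
  | succ m ih =>
    rw [sum_fin_succ_pi]
    simp only [Fin.sum_univ_succ, Fin.cons_zero, Fin.cons_succ, Finset.sum_add_distrib,
      ih (fun j => X j.succ) fun j => h1 _, Finset.sum_const, ← Finset.smul_sum, h1]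
    simp

theorem sum_pi_sum_sq {m : ℕ} (X : Fin m → β → ℝ) (v : Fin m → ℝ) (h1 : ∀ j, ∑ x, X j x = 0)
    (h2 : ∀ j, ∑ x, X j x ^ 2 = Fintype.card β * v j) :
    ∑ ω : Fin m → β, (∑ j, X j (ω j)) ^ 2 = Fintype.card β ^ m * ∑ j, v j := by
  induction m with
  | zero => simp
  | succ m ih =>
    have hi := ih (fun j => X j.succ) (fun j => v j.succ) (fun j => h1 _) fun j => h2 _
    rw [sum_fin_succ_pi]
    simp only [Fin.sum_univ_succ, Fin.cons_zero, Fin.cons_succ]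
    rw [sum_sum_add_sq _ _ (h1 0), hi, h2 0]
    simp only [Fintype.card_pi, Finset.prod_const, Finset.card_univ, Fintype.card_fin,
      Nat.cast_pow]
    ring

theorem sum_pi_sum_pow_four_le {m : ℕ} (X : Fin m → β → ℝ) (v : Fin m → ℝ)
    (h1 : ∀ j, ∑ x, X j x = 0) (h2 : ∀ j, ∑ x, X j x ^ 2 = Fintype.card β * v j)
    (h3 : ∀ j, ∑ x, X j x ^ 3 = 0) (h4 : ∀ j, ∑ x, X j x ^ 4 = Fintype.card β * v j) :
    ∑ ω : Fin m → β, (∑ j, X j (ω j)) ^ 4 ≤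
      Fintype.card β ^ m * (∑ j, v j + 3 * (∑ j, v j) ^ 2) := by
  induction m with
  | zero => simp
  | succ m ih =>
    have hi := ih (fun j => X j.succ) (fun j => v j.succ) (fun j => h1 _) (fun j => h2 _)
      (fun j => h3 _) fun j => h4 _
    have hi2 := sum_pi_sum_sq (fun j => X j.succ) (fun j => v j.succ) (fun j => h1 _) fun j => h2 _
    rw [sum_fin_succ_pi]
    simp only [Fin.sum_univ_succ, Fin.cons_zero, Fin.cons_succ]
    rw [sum_sum_add_pow_four _ _ (h1 0) (h3 0), hi2, h2 0, h4 0]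
    simp only [Fintype.card_pi, Finset.prod_const, Finset.card_univ, Fintype.card_fin,
      Nat.cast_pow]
    have hb : (0 : ℝ) ≤ Fintype.card β := Nat.cast_nonneg _
    have hbi := mul_le_mul_of_nonneg_left hi hb
    -- Expanding the square of the variance gives the cross term `6 * v 0 * ∑ j, v j.succ` exactly;
    -- `3 * v 0 ^ 2` is slack.
    have hb2 : (0 : ℝ) ≤ Fintype.card β ^ (m + 1) * (3 * v 0 ^ 2) := by positivity
    rw [pow_succ] at hb2 ⊢
    linarith

/-- An even polynomial minorant turns second and fourth moments into a lower bound on the first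
absolute moment. -/
theorem sub_pow_four_le_abs (y : ℝ) : y ^ 2 - y ^ 4 / 4 ≤ |y| := by
  rw [← sq_abs y, ← (by decide : Even 4).pow_abs y]
  have h : 0 ≤ |y| := abs_nonneg y
  generalize |y| = z at h
  nlinarith [mul_nonneg h (mul_nonneg (by linarith : 0 ≤ z + 2) (sq_nonneg (z - 1))),
    mul_nonneg h (sq_nonneg (z - 1))]

/-- A lower bound on the mean absolute value of a sum of independent variables. -/
theorem le_sum_pi_abs_sum {m : ℕ} (X : Fin m → β → ℝ) (v : Fin m → ℝ)
    (h1 : ∀ j, ∑ x, X j x = 0) (h2 : ∀ j, ∑ x, X j x ^ 2 = Fintype.card β * v j)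
    (h3 : ∀ j, ∑ x, X j x ^ 3 = 0) (h4 : ∀ j, ∑ x, X j x ^ 4 = Fintype.card β * v j)
    (hv : 1 / 64 ≤ ∑ j, v j) :
    Fintype.card β ^ m * (√(∑ j, v j) / 20) ≤ ∑ ω : Fin m → β, |∑ j, X j (ω j)| := by
  have m2 := sum_pi_sum_sq X v h1 h2
  have m4 := sum_pi_sum_pow_four_le X v h1 h2 h3 h4
  set V := ∑ j, v j
  set n : ℝ := (Fintype.card β : ℝ) ^ m
  have hn : 0 ≤ n := by positivity
  have hV : 0 < V := by linarith
  set r := √V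
  have hr : 0 < r := Real.sqrt_pos.2 hV
  have hrV : V = r ^ 2 := (Real.sq_sqrt hV.le).symm
  -- Rescaling by `5 * r` makes the quartic loss small: with `1 / r ≤ 64 * r`, what remains is at
  -- least `r / 5 - 67 * r / 500 ≥ r / 20`.
  have hpt : ∀ s : ℝ, s ^ 2 / (5 * r) - s ^ 4 / (4 * (5 * r) ^ 3) ≤ |s| := by
    intro s
    have h := mul_le_mul_of_nonneg_left (sub_pow_four_le_abs (s / (5 * r))) (by positivity :
      0 ≤ 5 * r)
    rw [abs_div, abs_of_pos (by positivity : 0 < 5 * r)] at h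
    refine (le_of_eq ?_).trans (h.trans_eq ?_) <;> field_simp
  calc n * (r / 20) ≤ n * V / (5 * r) - n * (V + 3 * V ^ 2) / (4 * (5 * r) ^ 3) := by
        have : n * V / (5 * r) - n * (V + 3 * V ^ 2) / (4 * (5 * r) ^ 3) =
            n * (r / 5 - (1 / r + 3 * r) / 500) := by
          rw [hrV]; field_simp; ring
        rw [this]
        refine mul_le_mul_of_nonneg_left ?_ hn
        have : 1 / r ≤ 64 * r := by
          rw [div_le_iff₀ hr]
          nlinarith
        linarith
    _ ≤ ∑ ω : Fin m → β, ((∑ j, X j (ω j)) ^ 2 / (5 * r) -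
          (∑ j, X j (ω j)) ^ 4 / (4 * (5 * r) ^ 3)) := by
        rw [Finset.sum_sub_distrib, ← Finset.sum_div, ← Finset.sum_div, m2]
        gcongr
    _ ≤ _ := Finset.sum_le_sum fun ω _ => hpt _

end Moments

/-! ### Random active episodes

The episodes are divided into blocks by an injective map `φ : Fin K → Fin m × Fin B`. In every
block there is at most one active episode, at a uniformly random position among `2 * B`, only the
first half of which exist, and the active episode has a uniformly random sign. -/

/-- What can be drawn in a block: a position (in the first half or in the second), and a sign. -/
abbrev Draw (B : ℕ) : Type := (Fin B ⊕ Fin B) × Bool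

/-- The episode at position `x` is active with sign `b`. -/
abbrev Hit {m B : ℕ} (ω : Fin m → Draw B) (x : Fin m × Fin B) (b : Bool) : Prop :=
  ω x.1 = (Sum.inl x.2, b)

/-- The number of active episodes of sign `b`. -/
def hitCount {K m B : ℕ} (φ : Fin K → Fin m × Fin B) (ω : Fin m → Draw B) (b : Bool) : ℕ :=
  ∑ k, if Hit ω (φ k) b then 1 else 0

/-- Overwriting coordinate `j` is a bijection between the points with value `x` there and those with
value `y`, and it preserves `f`. -/
theorem sum_mul_eq_of_update_eq {ι β : Type*} [Fintype ι] [DecidableEq ι] [Fintype β]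
    [DecidableEq β] (j : ι) (x y : β) (f : (ι → β) → ℝ≥0∞)
    (hf : ∀ ω, f (Function.update ω j x) = f (Function.update ω j y)) :
    ∑ ω, f ω * (if ω j = x then 1 else 0) = ∑ ω, f ω * if ω j = y then 1 else 0 := by
  simp only [mul_ite, mul_one, mul_zero]
  rw [← Finset.sum_filter, ← Finset.sum_filter]
  refine Finset.sum_nbij' (fun ω => Function.update ω j y) (fun ω => Function.update ω j x)
    ?_ ?_ ?_ ?_ ?_
  · simp
  · simp
  · rintro ω hω
    simp only [Finset.mem_filter, Finset.mem_univ, true_and] at hω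
    simp [← hω]
  · rintro ω hω
    simp only [Finset.mem_filter, Finset.mem_univ, true_and] at hω
    simp [← hω]
  · rintro ω hω
    simp only [Finset.mem_filter, Finset.mem_univ, true_and] at hω
    rw [← hf, ← hω, Function.update_eq_self]

section Hit

variable {K m B : ℕ} {φ : Fin K → Fin m × Fin B}

/-- Two draws that can only make episode `k` of its block active agree on all other episodes. -/
theorem hit_update_iff (hφ : Function.Injective φ) {i k : Fin K} (hik : i ≠ k)
    (ω : Fin m → Draw B) {x y : Draw B}
    (hx : ∀ q, x.1 = Sum.inl q → q = (φ k).2) (hy : ∀ q, y.1 = Sum.inl q → q = (φ k).2)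
    (b : Bool) :
    Hit (Function.update ω (φ k).1 x) (φ i) b ↔ Hit (Function.update ω (φ k).1 y) (φ i) b := by
  unfold Hit
  by_cases hj : (φ i).1 = (φ k).1
  · have hne : (φ i).2 ≠ (φ k).2 := fun h => hik (hφ (Prod.ext hj h))
    rw [hj, Function.update_self, Function.update_self]
    constructor
    · rintro rfl
      exact absurd (hx _ rfl) hne
    · rintro rfl
      exact absurd (hy _ rfl) hne
  · rw [Function.update_of_ne hj, Function.update_of_ne hj]

/-- Flipping the sign of an episode that is active changes nothing in the earlier episodes, so the
past does not tell the signs apart. -/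
theorem sum_mul_hit_comm (hφ : Function.Injective φ) (k : Fin K) (f : (Fin m → Draw B) → ℝ≥0∞)
    (hf : ∀ ω ω', (∀ i < k, ∀ b, Hit ω (φ i) b ↔ Hit ω' (φ i) b) → f ω = f ω') (b b' : Bool) :
    ∑ ω, f ω * (if Hit ω (φ k) b then 1 else 0) =
      ∑ ω, f ω * if Hit ω (φ k) b' then 1 else 0 := by
  refine sum_mul_eq_of_update_eq _ _ _ f fun ω => hf _ _ fun i hi b'' => ?_
  refine hit_update_iff hφ hi.ne ω ?_ ?_ b''
  · simp
  · simp

/-- This is why half of the positions do not exist. A draw activating episode `k` can be replaced by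
any of the `2 * B` empty draws without changing the earlier episodes. These alternatives are
disjoint and equally likely, even if the block has shown nothing so far. -/
theorem mul_sum_mul_hit_le (hφ : Function.Injective φ) (k : Fin K)
    (f : (Fin m → Draw B) → ℝ≥0∞)
    (hf : ∀ ω ω', (∀ i < k, ∀ b, Hit ω (φ i) b ↔ Hit ω' (φ i) b) → f ω = f ω') (b : Bool) :
    (2 * B : ℕ) * ∑ ω, f ω * (if Hit ω (φ k) b then 1 else 0) ≤ ∑ ω, f ω := by
  have h : ∀ x : Fin B × Bool, ∑ ω, f ω * (if Hit ω (φ k) b then 1 else 0) =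
      ∑ ω, f ω * if ω (φ k).1 = (Sum.inr x.1, x.2) then 1 else 0 := by
    intro x
    refine sum_mul_eq_of_update_eq _ _ _ f fun ω => hf _ _ fun i hi b'' => ?_
    refine hit_update_iff hφ hi.ne ω ?_ ?_ b''
    · simp
    · simp
  have hc : ((2 * B : ℕ) : ℝ≥0∞) = Fintype.card (Fin B × Bool) := by
    simp [mul_comm]
  rw [hc, ← nsmul_eq_mul, ← Finset.card_univ, ← Finset.sum_const,
    Finset.sum_congr rfl fun x _ => h x, Finset.sum_comm]
  refine Finset.sum_le_sum fun ω _ => ?_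
  rw [← Finset.mul_sum]
  refine mul_le_of_le_one_right zero_le ?_
  rcases ω (φ k).1 with ⟨q | q, c⟩
  · simp
  · calc _ = ∑ x : Fin B × Bool, if (q, c) = x then (1 : ℝ≥0∞) else 0 := by
          refine Finset.sum_congr rfl fun x _ => if_congr ?_ rfl rfl
          rw [Prod.ext_iff, Prod.ext_iff, Sum.inr.injEq]
      _ ≤ 1 := by simp

theorem hitCount_add_le (hφ : Function.Injective φ) (ω : Fin m → Draw B) :
    hitCount φ ω true + hitCount φ ω false ≤ m := by
  unfold hitCount
  rw [← Finset.sum_add_distrib]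
  have h : ∀ k, ((if Hit ω (φ k) true then 1 else 0) + if Hit ω (φ k) false then 1 else 0) =
      if (ω (φ k).1).1 = Sum.inl (φ k).2 then 1 else 0 := by
    intro k
    unfold Hit
    rcases ω (φ k).1 with ⟨q, _ | _⟩ <;> simp
  rw [Finset.sum_congr rfl fun k _ => h k, ← Finset.sum_filter, ← Finset.card_eq_sum_ones]
  calc _ ≤ (Finset.univ : Finset (Fin m)).card := by
        refine Finset.card_le_card_of_injOn (fun k => (φ k).1) (by simp) ?_
        intro i hi k hk hik
        simp only [Finset.coe_filter, Finset.mem_univ, true_and, Set.mem_ofPred_eq] at hi hk hik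
        rw [hik, hk] at hi
        exact hφ (Prod.ext hik (Sum.inl_injective hi).symm)
    _ = m := by simp

/-- The sign of the active episode of block `j` when `x` is drawn, zero if there is none. -/
def signedHit (φ : Fin K → Fin m × Fin B) (j : Fin m) (x : Draw B) : ℝ :=
  (if x.2 then 1 else -1) * ∑ k, if (φ k).1 = j ∧ x.1 = Sum.inl (φ k).2 then 1 else 0

theorem hitCount_sub (ω : Fin m → Draw B) :
    (hitCount φ ω true : ℝ) - hitCount φ ω false = ∑ j, signedHit φ j (ω j) := by
  unfold signedHit hitCount
  simp_rw [Finset.mul_sum]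
  rw [Finset.sum_comm, Nat.cast_sum, Nat.cast_sum, ← Finset.sum_sub_distrib]
  refine Finset.sum_congr rfl fun k _ => ?_
  rw [Finset.sum_eq_single (φ k).1]
  · unfold Hit
    rcases ω (φ k).1 with ⟨q, _ | _⟩ <;> by_cases hq : q = Sum.inl (φ k).2 <;> simp [hq]
  · intro j _ hj
    simp [hj.symm]
  · simp

/-- By injectivity at most one term is nonzero, so the sum is 0 or 1. -/
theorem sum_ite_sq (hφ : Function.Injective φ) (j : Fin m) (q : Fin B ⊕ Fin B) :
    (∑ k, if (φ k).1 = j ∧ q = Sum.inl (φ k).2 then (1 : ℝ) else 0) ^ 2 =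
      ∑ k, if (φ k).1 = j ∧ q = Sum.inl (φ k).2 then 1 else 0 := by
  by_cases h : ∃ k, (φ k).1 = j ∧ q = Sum.inl (φ k).2
  · obtain ⟨k, hk⟩ := h
    rw [Finset.sum_eq_single k, if_pos hk, one_pow]
    · intro i _ hik
      rw [if_neg]
      rintro ⟨h1, h2⟩
      exact hik (hφ (Prod.ext (h1.trans hk.1.symm) (Sum.inl_injective (h2.symm.trans hk.2))))
    · simp
  · rw [Finset.sum_eq_zero]
    · simp
    · intro k _
      exact if_neg fun hk => h ⟨k, hk⟩

theorem sum_signedHit_odd (j : Fin m) {d : ℕ} (hd : Odd d) :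
    ∑ x, signedHit φ j x ^ d = 0 := by
  rw [Fintype.sum_prod_type]
  refine Finset.sum_eq_zero fun q _ => ?_
  simp [signedHit, hd.neg_pow]

theorem sum_signedHit_sq (hφ : Function.Injective φ) (j : Fin m) :
    ∑ x, signedHit φ j x ^ 2 = 2 * ∑ k, if (φ k).1 = j then 1 else 0 := by
  have h : ∀ x : Draw B, signedHit φ j x ^ 2 =
      ∑ k, if (φ k).1 = j ∧ x.1 = Sum.inl (φ k).2 then 1 else 0 := by
    intro x
    rw [signedHit, mul_pow, sum_ite_sq hφ]
    split_ifs <;> simp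
  simp_rw [h]
  rw [Finset.sum_comm, Finset.mul_sum]
  refine Finset.sum_congr rfl fun k _ => ?_
  by_cases hk : (φ k).1 = j
  · rw [Fintype.sum_prod_type]
    simp [hk, ← mul_two]
  · simp [hk]

theorem signedHit_pow_four (hφ : Function.Injective φ) (j : Fin m) (x : Draw B) :
    signedHit φ j x ^ 4 = signedHit φ j x ^ 2 := by
  rw [signedHit, mul_pow, mul_pow, show 4 = 2 * 2 from rfl, pow_mul, pow_mul, sum_ite_sq hφ,
    sum_ite_sq hφ]
  split_ifs <;> simp

theorem card_draw (B : ℕ) : Fintype.card (Draw B) = 4 * B := by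
  simp; ring

theorem sum_hitCount_eq : ∑ ω, (hitCount φ ω true : ℝ) = ∑ ω, (hitCount φ ω false : ℝ) := by
  rw [← sub_eq_zero, ← Finset.sum_sub_distrib]
  simp_rw [hitCount_sub]
  exact sum_pi_sum_eq_zero _ fun j => by simpa using sum_signedHit_odd j odd_one

/-- On average, the smaller of the two counts is smaller than the first count by the order of the
standard deviation of their difference. -/
theorem le_sum_hitCount_sub_min (hφ : Function.Injective φ) (hB : 0 < B)
    (hK : 1 / 64 ≤ (K / (2 * B) : ℝ)) :
    Fintype.card (Fin m → Draw B) * (√(K / (2 * B)) / 40) ≤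
      ∑ ω, ((hitCount φ ω true : ℝ) - min (hitCount φ ω true : ℝ) (hitCount φ ω false)) := by
  have hB' : (0 : ℝ) < B := by exact_mod_cast hB
  -- The variance of block `j`: each of its episodes accounts for two of the `4 * B` draws, one per
  -- sign.
  let v (j : Fin m) : ℝ := (∑ k, if (φ k).1 = j then 1 else 0) / (2 * B)
  have hv : ∑ j, v j = K / (2 * B) := by
    rw [← Finset.sum_div, Finset.sum_comm]
    simp
  have h2 : ∀ j, ∑ x, signedHit φ j x ^ 2 = Fintype.card (Draw B) * v j := by
    intro j
    rw [sum_signedHit_sq hφ, card_draw]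
    simp only [v]
    push_cast
    field_simp
    ring
  have h := le_sum_pi_abs_sum (signedHit φ) v
    (fun j => by simpa using sum_signedHit_odd j odd_one) h2
    (fun j => sum_signedHit_odd j (by decide))
    (fun j => by simp_rw [signedHit_pow_four hφ]; exact h2 j) (hv ▸ hK)
  rw [hv] at h
  simp_rw [← hitCount_sub] at h
  -- The signed part averages to zero by symmetry, leaving half of the mean absolute difference.
  have hmin : ∀ ω : Fin m → Draw B,
      (hitCount φ ω true : ℝ) - min (hitCount φ ω true : ℝ) (hitCount φ ω false) =
        |(hitCount φ ω true : ℝ) - hitCount φ ω false| / 2 +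
          ((hitCount φ ω true : ℝ) - hitCount φ ω false) / 2 := by
    intro ω
    rcases le_total (hitCount φ ω true : ℝ) (hitCount φ ω false) with hle | hle
    · rw [min_eq_left hle, abs_of_nonpos (by linarith)]; ring
    · rw [min_eq_right hle, abs_of_nonneg (by linarith)]; ring
  simp_rw [hmin]
  rw [Finset.sum_add_distrib, ← Finset.sum_div, ← Finset.sum_div, Finset.sum_sub_distrib,
    sum_hitCount_eq, sub_self, zero_div, add_zero]
  have hc : (Fintype.card (Fin m → Draw B) : ℝ) = (Fintype.card (Draw B) : ℝ) ^ m := by simp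
  rw [hc]
  linarith

end Hit

namespace SSP

/-! ### Regret against costs drawn uniformly from a finite family -/

section Uniform

variable {M : SSP} {K : ℕ} {Ω : Type} [Fintype Ω] [Nonempty Ω]

theorem tsum_map_uniform_mul {α : Type*} (c : Ω → α) (F : α → ℝ≥0∞) :
    ∑' x, (PMF.uniformOfFintype Ω).map c x * F x =
      (Fintype.card Ω : ℝ≥0∞)⁻¹ * ∑ ω, F (c ω) := by
  rw [PMF.tsum_map_mul, tsum_fintype, Finset.mul_sum]
  simp_rw [PMF.uniformOfFintype_apply]

theorem coe_le_sub_of_ofReal_add_le {b : ℝ} {x y : ℝ≥0∞} (hb : 0 ≤ b) (hx : x ≠ ⊤)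
    (h : ENNReal.ofReal b + x ≤ y) : (b : EReal) ≤ (y : EReal) - (x : EReal) := by
  rw [EReal.le_sub_iff_add_le (Or.inl (EReal.coe_ennreal_ne_bot x))
    (Or.inl (by simpa using hx))]
  have := EReal.coe_ennreal_le_coe_ennreal_iff.2 h
  rwa [EReal.coe_ennreal_add, EReal.coe_ennreal_ofReal, max_eq_left hb] at this

theorem le_meanRegret_of_sum_le {b : ℝ} (hb : 0 ≤ b) (c : Ω → Fin K → M.Cost) (L : M.Learner)
    (hbest : ∀ ω, bestCost (c ω) ≠ ⊤)
    (h : ∑ ω, (ENNReal.ofReal b + bestCost (c ω)) ≤ ∑ ω, learnerCost (c ω) L) :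
    (b : EReal) ≤ meanRegret ((PMF.uniformOfFintype Ω).map c) L := by
  unfold meanRegret
  have hΩ : (Fintype.card Ω : ℝ≥0∞) ≠ 0 := by simp
  rw [tsum_map_uniform_mul c fun c => learnerCost c L, tsum_map_uniform_mul]
  refine coe_le_sub_of_ofReal_add_le hb ?_ ?_
  · exact ENNReal.mul_ne_top (by simp) (ENNReal.sum_ne_top.2 fun ω _ => hbest ω)
  · refine le_trans (le_of_eq ?_) (mul_le_mul_right h _)
    rw [Finset.sum_add_distrib, mul_add, Finset.sum_const, nsmul_eq_mul, Finset.card_univ,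
      ← mul_assoc, ENNReal.inv_mul_cancel hΩ (by simp), one_mul]

theorem exists_le_expectedRegret_of_sum_le {b : ℝ} (hb : 0 ≤ b) (c : Ω → Fin K → M.Cost)
    (L : M.Learner) (hbest : ∀ ω, bestCost (c ω) ≠ ⊤)
    (h : ∑ ω, (ENNReal.ofReal b + bestCost (c ω)) ≤ ∑ ω, learnerCost (c ω) L) :
    ∃ ω, (b : EReal) ≤ expectedRegret (c ω) L := by
  by_contra! hlt
  refine absurd h (not_le.2 (ENNReal.sum_lt_sum_of_nonempty Finset.univ_nonempty fun ω _ => ?_))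
  by_contra! hle
  exact absurd (coe_le_sub_of_ofReal_add_le hb (hbest ω) hle) (not_le.2 (hlt ω))

end Uniform

/-! ### The hard instance -/

/-- The probabilities of reaching the goal: one fast action, and two slow ones. -/
def exitProb (D T : ℝ) (a : Option Bool) : ℝ≥0∞ :=
  (ENNReal.ofReal (a.elim D fun _ => T))⁻¹

/-- The costs: the fast action always costs one, and a slow action costs one in the active episodes
of its sign. -/
def hitCost {K m B : ℕ} (φ : Fin K → Fin m × Fin B) (ω : Fin m → Draw B) (k : Fin K)
    (a : Option Bool) : Set.Icc (0 : ℝ) 1 :=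
  a.elim 1 fun b => if Hit ω (φ k) b then 1 else 0

section HardInstance

variable {D T : ℝ} {K m B : ℕ} {φ : Fin K → Fin m × Fin B}

theorem exitProb_le_one (hD : 1 ≤ D) (hT : D ≤ T) (a : Option Bool) : exitProb D T a ≤ 1 := by
  rw [exitProb, ENNReal.inv_le_one, ENNReal.one_le_ofReal]
  cases a with
  | none => exact hD
  | some b => exact hD.trans hT

theorem exitProb_ne_zero (a : Option Bool) : exitProb D T a ≠ 0 := by
  simp [exitProb]

theorem inv_exitProb (a : Option Bool) :
    (exitProb D T a)⁻¹ = ENNReal.ofReal (a.elim D fun _ => T) := by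
  rw [exitProb, inv_inv]

theorem iInf_inv_exitProb (hT : D ≤ T) : ⨅ a, (exitProb D T a)⁻¹ = ENNReal.ofReal D := by
  simp_rw [inv_exitProb]
  refine le_antisymm (iInf_le _ none) (le_iInf fun a => ENNReal.ofReal_le_ofReal ?_)
  cases a with
  | none => exact le_rfl
  | some b => exact hT

theorem ofReal_hitCost_some (ω : Fin m → Draw B) (k : Fin K) (b : Bool) :
    ENNReal.ofReal (hitCost φ ω k (some b)) = if Hit ω (φ k) b then 1 else 0 := by
  simp only [hitCost, Option.elim_some]
  split_ifs <;> simp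

theorem ofReal_hitCost_none (ω : Fin m → Draw B) (k : Fin K) :
    ENNReal.ofReal (hitCost φ ω k none) = 1 := by
  simp [hitCost]

/-- The total cost of the policy that always takes action `a`. -/
theorem inv_exitProb_mul_sum_hitCost (ω : Fin m → Draw B) (a : Option Bool) (hT : 0 ≤ T) :
    (exitProb D T a)⁻¹ * ∑ k : Fin K, ENNReal.ofReal (hitCost φ ω k a) =
      ENNReal.ofReal (a.elim (D * K) fun b => T * hitCount φ ω b) := by
  rw [inv_exitProb]
  cases a with
  | none =>
    simp_rw [ofReal_hitCost_none]
    simp [ENNReal.ofReal_mul' (Nat.cast_nonneg K)]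
  | some b =>
    simp_rw [ofReal_hitCost_some]
    simp [ENNReal.ofReal_mul hT, hitCount]

variable (hD : 1 ≤ D) (hT : D ≤ T)

/-- Whatever the learner does, she pays on average as much as by always taking a slow action. -/
theorem sum_hitCount_le_sum_learnerCost (hφ : Function.Injective φ) (hB : T ≤ D * (2 * B))
    (L : (oneState (exitProb D T) (exitProb_le_one hD hT)).Learner) :
    ∑ ω, ENNReal.ofReal (T * hitCount φ ω true) ≤
      ∑ ω, learnerCost (fun k _ a => hitCost φ ω k a) L := by
  have hD0 : 0 < D := by linarith
  have hT0 : 0 < T := by linarith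
  refine le_trans (le_of_eq ?_) (sum_le_sum_learnerCost_oneState exitProb_ne_zero
    (fun ω k _ a => hitCost φ ω k a)
    (fun k ω => ENNReal.ofReal T * if Hit ω (φ k) true then 1 else 0) ?_ L)
  · refine Finset.sum_congr rfl fun ω _ => ?_
    rw [← Finset.mul_sum, ENNReal.ofReal_mul hT0.le, hitCount]
    simp
  · intro k a f hf
    have hf' : ∀ ω ω', (∀ i < k, ∀ b, Hit ω (φ i) b ↔ Hit ω' (φ i) b) → f ω = f ω' := by
      refine fun ω ω' h => hf _ _ fun i hi => ?_
      ext s a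
      cases a <;> simp [hitCost, h i hi]
    simp_rw [mul_left_comm (f _)]
    rw [← Finset.mul_sum, ← mul_assoc]
    -- For a slow action `T` cancels against the exit probability and sign symmetry concludes; for
    -- the fast one the factor `T / D` is absorbed by `2 * B`.
    cases a with
    | some b =>
      simp_rw [ofReal_hitCost_some]
      rw [exitProb, Option.elim_some, ENNReal.inv_mul_cancel (by simpa using hT0) (by simp),
        one_mul, sum_mul_hit_comm hφ k f hf' true b]
    | none =>
      simp_rw [ofReal_hitCost_none, mul_one]
      refine le_trans ?_ (mul_sum_mul_hit_le hφ k f hf' true)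
      gcongr
      rw [exitProb, Option.elim_none, ← ENNReal.ofReal_inv_of_pos hD0,
        ← ENNReal.ofReal_mul (by positivity), ← ENNReal.ofReal_natCast]
      refine ENNReal.ofReal_le_ofReal ?_
      rw [inv_mul_le_iff₀ hD0]
      exact_mod_cast hB

theorem bestCost_hitCost_le (ω : Fin m → Draw B) :
    bestCost (M := oneState (exitProb D T) (exitProb_le_one hD hT))
      (fun k _ a => hitCost φ ω k a) ≤
        ENNReal.ofReal (T * min (hitCount φ ω true : ℝ) (hitCount φ ω false)) := by
  have h : ∀ b, bestCost (M := oneState (exitProb D T) (exitProb_le_one hD hT))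
      (fun k _ a => hitCost φ ω k a) ≤ ENNReal.ofReal (T * hitCount φ ω b) := fun b =>
    (bestCost_oneState_le exitProb_ne_zero _ (some b)).trans_eq
      (inv_exitProb_mul_sum_hitCost ω (some b) (by linarith))
  rcases min_choice (hitCount φ ω true : ℝ) (hitCount φ ω false) with hm | hm <;> rw [hm]
  exacts [h true, h false]

theorem sum_ofReal_add_bestCost_le (hφ : Function.Injective φ) (hB0 : 0 < B)
    (hB : T ≤ D * (2 * B)) (hK : 1 / 64 ≤ (K / (2 * B) : ℝ)) {b : ℝ} (hb0 : 0 ≤ b)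
    (hb : b ≤ T * (√(K / (2 * B)) / 40))
    (L : (oneState (exitProb D T) (exitProb_le_one hD hT)).Learner) :
    ∑ ω, (ENNReal.ofReal b + bestCost (M := oneState (exitProb D T) (exitProb_le_one hD hT))
      (fun k _ a => hitCost φ ω k a)) ≤ ∑ ω, learnerCost (fun k _ a => hitCost φ ω k a) L := by
  have hT0 : 0 < T := by linarith
  refine le_trans ?_ (sum_hitCount_le_sum_learnerCost hD hT hφ hB L)
  calc _ ≤ ∑ ω : Fin m → Draw B, ENNReal.ofReal
        (b + T * min (hitCount φ ω true : ℝ) (hitCount φ ω false)) := by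
        refine Finset.sum_le_sum fun ω _ => ?_
        rw [ENNReal.ofReal_add hb0 (by positivity)]
        gcongr
        exact bestCost_hitCost_le hD hT ω
    _ ≤ _ := by
        rw [← ENNReal.ofReal_sum_of_nonneg fun ω _ => by positivity,
          ← ENNReal.ofReal_sum_of_nonneg fun ω _ => by positivity]
        refine ENNReal.ofReal_le_ofReal ?_
        have h := mul_le_mul_of_nonneg_left (le_sum_hitCount_sub_min (m := m) hφ hB0 hK) hT0.le
        rw [Finset.sum_sub_distrib, mul_sub] at h
        rw [Finset.sum_add_distrib, ← Finset.mul_sum, ← Finset.mul_sum, Finset.sum_const,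
          nsmul_eq_mul, Finset.card_univ]
        have := mul_le_mul_of_nonneg_left hb (Nat.cast_nonneg (α := ℝ)
          (Fintype.card (Fin m → Draw B)))
        linarith

/-- Every optimal policy takes a slow action. -/
theorem hittingTime_of_isOptimal_hitCost (ω : Fin m → Draw B)
    (hlt : T * min (hitCount φ ω true : ℝ) (hitCount φ ω false) < D * K)
    (π : (oneState (exitProb D T) (exitProb_le_one hD hT)).Policy)
    (hπ : IsOptimal (fun k _ a => hitCost φ ω k a) π) (s) :
    hittingTime π s = ENNReal.ofReal T := by
  rw [hittingTime_oneState, inv_exitProb]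
  have hcost : policyCost (fun k _ a => hitCost φ ω k a) π =
      ENNReal.ofReal ((π ()).elim (D * K) fun b => T * hitCount φ ω b) :=
    (policyCost_oneState _ π).trans (inv_exitProb_mul_sum_hitCost ω _ (by linarith))
  cases ha : π () with
  | some b => rfl
  | none =>
    exfalso
    rw [ha, Option.elim_none] at hcost
    have hle : policyCost (fun k _ a => hitCost φ ω k a) π ≤
        bestCost (M := oneState (exitProb D T) (exitProb_le_one hD hT))
          (fun k _ a => hitCost φ ω k a) :=
      le_iInf fun π' => hπ.2 π'.1 π'.2
    have := (hcost.symm.trans_le hle).trans (bestCost_hitCost_le hD hT ω)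
    rw [ENNReal.ofReal_le_ofReal_iff (mul_nonneg (by linarith) (by positivity))] at this
    linarith

end HardInstance

/-- The division of the episodes into blocks of length `B`. -/
def episodeBlock (K B : ℕ) (hB : 0 < B) (k : Fin K) : Fin ((K - 1) / B + 1) × Fin B :=
  (⟨k / B, Nat.lt_succ_of_le (Nat.div_le_div_right (by omega))⟩, ⟨k % B, Nat.mod_lt _ hB⟩)

theorem episodeBlock_injective (K B : ℕ) (hB : 0 < B) :
    Function.Injective (episodeBlock K B hB) := by
  intro i k h
  simp only [episodeBlock, Prod.mk.injEq, Fin.mk.injEq] at h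
  ext
  rw [← Nat.div_add_mod (i : ℕ) B, ← Nat.div_add_mod (k : ℕ) B, h.1, h.2]

/-- The smaller count is at most half the number of blocks, and rounding down makes it at most `(K -
1) / B`, even when there is only one block. -/
theorem mul_min_hitCount_lt {D T : ℝ} {K B : ℕ} (hB : 0 < B) (hK : 0 < K) (hD : 0 < D)
    (hDB : T < D * B) (ω : Fin ((K - 1) / B + 1) → Draw B) :
    T * min (hitCount (episodeBlock K B hB) ω true : ℝ) (hitCount (episodeBlock K B hB) ω false) <
      D * K := by
  have h := hitCount_add_le (episodeBlock_injective K B hB) ω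
  rw [← Nat.cast_min]
  have h1 := min_le_left (hitCount (episodeBlock K B hB) ω true)
    (hitCount (episodeBlock K B hB) ω false)
  have h2 := min_le_right (hitCount (episodeBlock K B hB) ω true)
    (hitCount (episodeBlock K B hB) ω false)
  generalize min (hitCount (episodeBlock K B hB) ω true)
    (hitCount (episodeBlock K B hB) ω false) = n at h1 h2 ⊢
  have h0 := Nat.zero_le ((K - 1) / B)
  have hn : n ≤ (K - 1) / B := by omega
  have hnB : B * n < K := by
    have := (Nat.mul_le_mul_left B hn).trans (Nat.mul_div_le (K - 1) B)
    omega
  have hnB' : (B * n : ℝ) < K := by exact_mod_cast hnB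
  calc T * n ≤ D * B * n := by gcongr
    _ < D * K := by rw [mul_assoc]; gcongr

end SSP

end

theorem mainTheorem4 :
    ∃ C : ℝ, 0 < C ∧
      ∀ (D T : ℝ) (K : ℕ), 1 ≤ D → D ≤ T → T ≤ 16 * D * K →
        ∃ M : SSP,
          (∃ π : M.Policy, SSP.IsProper π) ∧
          M.diameter = ENNReal.ofReal D ∧
          ∃ μ : PMF (Fin K → M.Cost),
            (∀ c ∈ μ.support,
              (∃ π : M.Policy, SSP.IsOptimal c π) ∧
              ∀ π : M.Policy, SSP.IsOptimal c π →
                SSP.hittingTime π M.init = ENNReal.ofReal T) ∧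
            ∀ L : M.Learner,
              ((C * Real.sqrt (D * T * K) : ℝ) : EReal) ≤ SSP.meanRegret μ L ∧
              ∃ c ∈ μ.support,
                ((C * Real.sqrt (D * T * K) : ℝ) : EReal) ≤ SSP.expectedRegret c L := by
  -- The factor `1 / 40` comes from the mean gap of the counts, and another `1 / 2` from bounding
  -- the variance below by `D * K / (4 * T)`.
  refine ⟨1 / 80, by norm_num, fun D T K hD hT hK => ?_⟩
  have hD0 : 0 < D := by linarith
  have hT0 : 0 < T := by linarith
  have hK0 : 0 < K := by
    rcases Nat.eq_zero_or_pos K with rfl | h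
    · simp at hK; linarith
    · exact h
  have hKR : (0 : ℝ) < K := by exact_mod_cast hK0
  -- Strictly more than `T / D`, so that slow policies win strictly, and at most `2 * T / D`, so
  -- that the variance stays large.
  let B := ⌊T / D⌋₊ + 1
  have hB : 0 < B := Nat.succ_pos _
  have hBR : (0 : ℝ) < B := by exact_mod_cast hB
  have hTB : T < D * B := by
    have := Nat.lt_floor_add_one (T / D)
    rw [div_lt_iff₀ hD0] at this
    simp only [B]
    push_cast
    linarith
  have hBT : D * B ≤ 2 * T := by
    have h := Nat.floor_le (div_nonneg hT0.le hD0.le)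
    rw [le_div_iff₀ hD0] at h
    simp only [B]
    push_cast
    linarith
  have hv : D * K / (4 * T) ≤ K / (2 * B) := by
    rw [div_le_div_iff₀ (by positivity) (by positivity)]
    have := mul_le_mul_of_nonneg_left hBT hKR.le
    linarith
  -- The assumption `T ≤ 16 * D * K` is what keeps the variance away from zero.
  have hv0 : 1 / 64 ≤ (K / (2 * B) : ℝ) := by
    refine le_trans ?_ hv
    rw [div_le_div_iff₀ (by positivity) (by positivity)]
    linarith
  have hb : 1 / 80 * √(D * T * K) ≤ T * (√(K / (2 * B)) / 40) := by
    have h : √(D * T * K) ≤ 2 * T * √(K / (2 * B)) := by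
      rw [Real.sqrt_le_left (by positivity), mul_pow, Real.sq_sqrt (by positivity)]
      calc D * T * K = (2 * T) ^ 2 * (D * K / (4 * T)) := by field_simp; ring
        _ ≤ _ := by gcongr
    linarith
  let φ := SSP.episodeBlock K B hB
  have hφ : Function.Injective φ := SSP.episodeBlock_injective K B hB
  let M := SSP.oneState (SSP.exitProb D T) (SSP.exitProb_le_one hD hT)
  let c (ω : Fin ((K - 1) / B + 1) → Draw B) : Fin K → M.Cost := fun k _ a => SSP.hitCost φ ω k a
  have hne : Nonempty (Draw B) := ⟨(Sum.inl ⟨0, hB⟩, true)⟩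
  have hbest (ω) : SSP.bestCost (c ω) ≠ ⊤ :=
    ne_top_of_le_ne_top ENNReal.ofReal_ne_top (SSP.bestCost_hitCost_le hD hT ω)
  have hsum (L : M.Learner) := SSP.sum_ofReal_add_bestCost_le hD hT hφ hB
    (by linarith [mul_pos hD0 hBR]) hv0 (by positivity) hb L
  refine ⟨M, ⟨fun _ => none, SSP.isProper_oneState _ (SSP.exitProb_ne_zero _)⟩,
    (SSP.diameter_oneState SSP.exitProb_ne_zero).trans (SSP.iInf_inv_exitProb hT),
    (PMF.uniformOfFintype _).map c, ?_, fun L => ⟨?_, ?_⟩⟩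
  · intro c' hc'
    obtain ⟨ω, -, rfl⟩ := (PMF.mem_support_map_iff _ _ _).1 hc'
    refine ⟨SSP.exists_isOptimal_oneState SSP.exitProb_ne_zero _, fun π hπ => ?_⟩
    exact SSP.hittingTime_of_isOptimal_hitCost hD hT ω
      (SSP.mul_min_hitCount_lt hB hK0 hD0 hTB ω) π hπ _
  · exact SSP.le_meanRegret_of_sum_le (by positivity) c L hbest (hsum L)
  · obtain ⟨ω, hω⟩ := SSP.exists_le_expectedRegret_of_sum_le (by positivity) c L hbest (hsum L)
    exact ⟨c ω, (PMF.mem_support_map_iff _ _ _).2 ⟨ω, PMF.mem_support_uniformOfFintype ω, rfl⟩, hω⟩
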